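/- **Setting.** A single server serves $n$ jobs in $k\ge 2$ queues. Job $i$ arrives at time $r_i\ge 0$ in queue $q_i\in\{1,\dots,k\}$, and its workload $p_i$ becomes known on arrival. Service is non-preemptive. A setup of length $\tau\ge 0$ is needed whenever the server switches to another queue, and also before its first service (no queue is set up at time $0$); a setup can be interrupted, but its progress is then lost, and the server remains in its former queue. For an instance $I=\{(r_i,q_i,p_i)\}_{i\le n}$ and a policy $\pi$, $C^{\pi}(I)$ is the sum of the completion times of all jobs, and $C^*(I)$ is the infimum of the total completion time over all feasible non-preemptive (offline) schedules. **GIPP triggered at time $T$** with a set $U$ of unserved jobs: simulate on $U$, from time $T$ on, the preemptive shortest-remaining-processing-time rule (SRPT) on a machine without setup times; let $d_i$ be the completion time of job $i\in U$ in this simulation. Whenever the server is free at a time $t\ge T$, it takes, among the unserved jobs with $d_i\le t$, one with the largest Gittins index, which is $1/p_i$ if the server is set up for the queue of job $i$ and $1/(p_i+\tau)$ otherwise, sets up its queue if necessary, and serves it; if there is no such job, it waits for the next $d_i$. **Mixed strategy $\pi^m$** with threshold $\eta p_{\min}$: as long as no job with workload larger than $\eta p_{\min}$ has arrived, use the cyclic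 exhaustive policy without waiting that skips empty queues: whenever the server is free, it serves a shortest job present in its current queue; if this queue is empty, it sets up the next non-empty queue in the cyclic order $1,\dots,k,1,\dots$ and then serves a shortest job present there; if all queues are empty, it stays where it is until the next arrival. (Before its first setup it begins the cycle with queue $1$.) When a job with workload larger than $\eta p_{\min}$ arrives, the server finishes the current service if it is serving, halts the setup and stays in its former queue if it is setting up (this includes an arrival at the very end of a setup), and from then on GIPP is used for all unserved jobs. All ties are broken by the smallest job index. **Theorem.** Let $\kappa(\eta)=\max\{\tfrac32\eta,\,k+1\}$. Let $p_{\min}>0$, $0\le\tau\le\theta p_{\min}$, $\eta\le\theta$ and $\kappa(\eta)\le\theta+2$. Let the $r_i\ge 0$ and $q_i$ be arbitrary and fixed, and let the workloads $p_1,\dots,p_n$ be i.i.d. random variables with $p_i\ge p_{\min}$ almost surely. Then the ratio $C^{\pi^m}(I)/C^*(I)$ (read as $0$ if $n=0$) is integrable, and $$\mathbf E\!\left[\frac{C^{\pi^m}(I)}{C^*(I)}\right]\le \kappa(\eta)\,\mu^{n}+(\theta+2)\,(1-\mu^{n}),\qquad \mu=\mathbf P(p_i\le\eta p_{\min}).$$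 -/

import Mathlib

open MeasureTheory ProbabilityTheory

noncomputable section

/-- An instance of the polling problem with `k` queues and `n` jobs: job `i` arrives at time
`release i` in queue `queue i` and needs `work i` units of service. -/
structure PollingInstance (k n : ℕ) where
  release : Fin n → ℝ
  queue : Fin n → Fin k
  work : Fin n → ℝ

namespace PollingInstance

variable {k n : ℕ}

/-! ### The offline problem -/

/-- Non-preemptive schedules of the offline problem, given by the starting times `s i` of the
services. No queue is set up at time `0`, so that every service is preceded by at least one setup
of length `τ`; a further setup takes place between two services in different queues. (If the
services in between are those of yet other queues, the gaps between consecutive services already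
force the pairwise condition.) -/
structure IsSchedule (I : PollingInstance k n) (τ : ℝ) (s : Fin n → ℝ) : Prop where
  release_le : ∀ i, I.release i ≤ s i
  first_setup : ∀ i, τ ≤ s i
  separated : ∀ i j, i ≠ j →
    s i + I.work i + (if I.queue i = I.queue j then 0 else τ) ≤ s j ∨
    s j + I.work j + (if I.queue i = I.queue j then 0 else τ) ≤ s i

/-- The optimal total completion time `C*` of the offline problem. -/
def optCost (I : PollingInstance k n) (τ : ℝ) : ℝ :=
  sInf {c : ℝ | ∃ s, I.IsSchedule τ s ∧ c = ∑ i, (s i + I.work i)}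

/-! ### Policies -/

/-- The element of `S` at which `f` is smallest, the one of lowest index in case of a tie;
`none` if `S` is empty. -/
def firstArgmin (S : Finset (Fin n)) (f : Fin n → ℝ) : Option (Fin n) :=
  (List.finRange n).find? fun i => decide (i ∈ S ∧ ∀ j ∈ S, f i ≤ f j)

/-- The time needed to make the server ready for queue `v`. The queue that is currently set up is
`loc`; `none` means that no queue has been set up so far. -/
def setupTime (τ : ℝ) (loc : Option (Fin k)) (v : Fin k) : ℝ :=
  if loc = some v then 0 else τ

/-- Simulation of the preemptive rule SRPT (shortest remaining processing time first) on a machine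
without setup times: `t` is the current time, `a j` the time from which job `j` is available,
`w j` its remaining processing time, and `U` is the set of unfinished jobs. The result is the
vector of the completion times of the jobs in `U`. Each step lasts until the running job is
finished or the next job becomes available; the first argument bounds the number of steps. -/
def srptRun (a : Fin n → ℝ) : ℕ → ℝ → (Fin n → ℝ) → Finset (Fin n) → Fin n → ℝ
  | 0, _, _, _ => fun _ => 0
  | m + 1, t, w, U =>
    match firstArgmin (U.filter fun j => a j ≤ t) w,
        firstArgmin (U.filter fun j => t < a j) a with
    | none, none => fun _ => 0
    | none, some l => srptRun a m (a l) w U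
    | some i, none =>
        Function.update (srptRun a m (t + w i) w (U.erase i)) i (t + w i)
    | some i, some l =>
        if t + w i ≤ a l then
          Function.update (srptRun a m (t + w i) w (U.erase i)) i (t + w i)
        else
          srptRun a m (a l) (Function.update w i (w i - (a l - t))) U

/-- The completion times under SRPT, started at time `T` on the set `U` of jobs. There are at most
`n` completions and at most `n` times at which jobs become available, so `2 * n` steps suffice. -/
def srptCompletion (I : PollingInstance k n) (T : ℝ) (U : Finset (Fin n)) : Fin n → ℝ :=
  srptRun (fun j => max (I.release j) T) (2 * n) T I.work U

/-- The Gittins index of job `i` when the server is at `loc`. -/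
def gittinsIndex (I : PollingInstance k n) (τ : ℝ) (loc : Option (Fin k)) (i : Fin n) : ℝ :=
  1 / (I.work i + setupTime τ loc (I.queue i))

/-- GIPP with given availability times `d` (those are completion times of a simulated SRPT): whenever
the server is free, it takes among the jobs with `d j ≤ t` one of largest Gittins index, sets up
its queue if necessary, and serves it; if there is no such job, the server waits for the next one.
The server is free at time `t` in queue `loc`, the jobs in `U` are unserved, and the result is the
sum of their completion times. The first argument bounds the number of services. -/
def gippRun (I : PollingInstance k n) (τ : ℝ) (d : Fin n → ℝ) :
    ℕ → ℝ → Option (Fin k) → Finset (Fin n) → ℝ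
  | 0, _, _, _ => 0
  | m + 1, t, loc, U =>
    match firstArgmin U d with
    | none => 0
    | some j =>
      let t₀ := max t (d j)
      match firstArgmin (U.filter fun i => d i ≤ t₀) (fun i => -I.gittinsIndex τ loc i) with
      | none => 0
      | some i =>
        let c := t₀ + setupTime τ loc (I.queue i) + I.work i
        c + gippRun I τ d m c (some (I.queue i)) (U.erase i)

/-- The total completion time of the jobs in `U` under GIPP, triggered at time `T` with the server
at `loc`. -/
def gippCost (I : PollingInstance k n) (τ T : ℝ) (loc : Option (Fin k))
    (U : Finset (Fin n)) : ℝ :=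
  I.gippRun τ (I.srptCompletion T U) U.card T loc U

/-- Number of steps from the current queue to queue `v` in the cyclic order `0, 1, …, k - 1, 0, …`;
a server that has not been set up yet begins its cycle with queue `0`. -/
def cyclicDist (loc : Option (Fin k)) (v : Fin k) : ℕ :=
  match loc with
  | none => (v : ℕ)
  | some c => ((v : ℕ) + k - (c : ℕ)) % k

/-- The deterministic mixed strategy. The server is free at time `t` in queue `loc`, and `U` is the
set of unserved jobs; the result is the sum of their completion times. The first argument bounds
the number of services. The jobs of workload larger than `b` are the large ones.

If no job is waiting, the server stays where it is until the next arrival, so that `t₀` is the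
next time at which the server is free and jobs are waiting. If a large job is present then, GIPP
takes over. Otherwise, the server turns to the next non-empty queue `v` in the cyclic order,
beginning with the current one. If `v` is the current queue, it serves a shortest job of `v`. If
not, it sets up `v` during `[t₀, t₀ + τ]` and then serves a shortest job that is present in `v`;
but if a large job arrives during the setup, then the setup is halted, the server stays in its
former queue, and GIPP takes over at once. -/
def mixedRun (I : PollingInstance k n) (τ b : ℝ) :
    ℕ → ℝ → Option (Fin k) → Finset (Fin n) → ℝ
  | 0, _, _, _ => 0
  | m + 1, t, loc, U =>
    match firstArgmin U I.release with
    | none => 0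
    | some j =>
      let t₀ := max t (I.release j)
      if ∃ i ∈ U, b < I.work i ∧ I.release i ≤ t₀ then
        I.gippCost τ t₀ loc U
      else
        match firstArgmin (U.filter fun i => I.release i ≤ t₀)
            (fun i => (cyclicDist loc (I.queue i) : ℝ)) with
        | none => 0
        | some a =>
          let v := I.queue a
          let s := t₀ + setupTime τ loc v
          match firstArgmin (U.filter fun i => b < I.work i ∧ I.release i ≤ s) I.release with
          | some l => I.gippCost τ (I.release l) loc U
          | none =>
            match firstArgmin (U.filter fun i => I.queue i = v ∧ I.release i ≤ s) I.work with
            | none => 0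
            | some i =>
              let c := s + I.work i
              c + mixedRun I τ b m c (some v) (U.erase i)

/-- The total completion time of the mixed strategy with threshold `b`, started at time `0` with no
queue set up. -/
def mixedCost (I : PollingInstance k n) (τ b : ℝ) : ℝ :=
  I.mixedRun τ b n 0 none Finset.univ

end PollingInstance

/-- The competitive ratio `κ(η) = max {3η/2, k + 1}` of the cyclic exhaustive policies. -/
def cyclicRatio (k : ℕ) (η : ℝ) : ℝ := max (3 / 2 * η) ((k : ℝ) + 1)

end

noncomputable section

namespace PollingInstance

variable {k n : ℕ}

/-! ### Smallest elements -/

/-! The expectation enters only at the end: the ratio is at most `cyclicRatio k η` when no job is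
large, and at most `θ + 2` in general, for every realisation with workloads at least `pmin`. Since
the workloads are i.i.d., all jobs are small with probability `μ ^ n`.

Both pointwise bounds come from `mixedCost_le_mul_optCost`. Fix an offline schedule and let `c m` be
its completion times in increasing order. Costs are compared rank by rank: `m + 1` jobs need at
least a setup and `m + 1` services, so `c m ≥ τ + (m + 1) * pmin`; and if the policy has served only
`m` jobs, one of the first `m + 1` offline jobs is still unserved, so its release time is at most `c
m`.

In the cyclic phase a waiting job sees at most `k` setups and, counted generously, all `L` services
so far, each at most `b`. The next service therefore ends by `c L + k * τ + (L + 1) * b ≤ K * c L`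
whenever `k` and `b / pmin` are at most `K - 1` (`mixedRun_le_sum_Ico`).

In the GIPP phase, index priority is no worse than serving in the order of the SRPT completions `d`,
paying a setup each time (`gippRun_le`). SRPT does all work finished by `d j` within `[T, d j]`, and
each setup costs at most `θ` times the workload, which gives `(θ + 2) * d j - (θ + 1) * T` per job
(`gippCost_le`). SRPT maximises the number of jobs finished by any time (`card_le_card_srptRun_le`),
so the `d j` can be compared with the `c m`. The late start `T` is paid for by the term `(θ + 1) *
T` and by the work the offline schedule must also have done (`gippCost_le_sum_Ico`). -/

lemma firstArgmin_spec {S : Finset (Fin n)} {f : Fin n → ℝ} {i : Fin n}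
    (h : firstArgmin S f = some i) : i ∈ S ∧ ∀ j ∈ S, f i ≤ f j := by
  have := List.find?_some h
  simpa using this

lemma eq_empty_of_firstArgmin {S : Finset (Fin n)} {f : Fin n → ℝ}
    (h : firstArgmin S f = none) : S = ∅ := by
  by_contra hS
  obtain ⟨i, hi, hmin⟩ := S.exists_min_image f (Finset.nonempty_iff_ne_empty.2 hS)
  have := List.find?_eq_none.1 h i (List.mem_finRange i)
  exact this (by simpa using ⟨hi, hmin⟩)

/-! ### Shortest remaining processing time -/

/-- The number of unfinished jobs plus the number of jobs not yet available is the potential that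
bounds the simulation steps: a completion lowers the first term, and waiting for an availability
time lowers the second. -/
lemma card_erase_add_card_filter_le {a : Fin n → ℝ} {m : ℕ} {t t' : ℝ} {U : Finset (Fin n)}
    {i : Fin n} (hi : i ∈ U) (ht : t ≤ t')
    (hm : U.card + (U.filter fun j => t < a j).card ≤ m + 1) :
    (U.erase i).card + ((U.erase i).filter fun j => t' < a j).card ≤ m := by
  have h1 := Finset.card_erase_add_one hi
  have h2 : ((U.erase i).filter fun j => t' < a j).card ≤ (U.filter fun j => t < a j).card :=
    Finset.card_le_card fun j hj => by
      simp only [Finset.mem_filter, Finset.mem_erase] at hj ⊢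
      exact ⟨hj.1.2, ht.trans_lt hj.2⟩
  omega

lemma card_add_card_filter_lt {a : Fin n → ℝ} {m : ℕ} {t : ℝ} {U : Finset (Fin n)}
    {l : Fin n} (hl : l ∈ U) (ht : t < a l)
    (hm : U.card + (U.filter fun j => t < a j).card ≤ m + 1) :
    U.card + (U.filter fun j => a l < a j).card ≤ m := by
  have h2 : (U.filter fun j => a l < a j).card < (U.filter fun j => t < a j).card := by
    refine Finset.card_lt_card ⟨fun j hj => ?_, fun h => ?_⟩
    · simp only [Finset.mem_filter] at hj ⊢
      exact ⟨hj.1, ht.trans hj.2⟩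
    · have := h (Finset.mem_filter.2 ⟨hl, ht⟩)
      simp at this
  omega

lemma eq_empty_of_filter_eq_empty {a : Fin n → ℝ} {t : ℝ} {U : Finset (Fin n)}
    (h1 : (U.filter fun j => a j ≤ t) = ∅) (h2 : (U.filter fun j => t < a j) = ∅) : U = ∅ := by
  refine Finset.eq_empty_of_forall_notMem fun j hj => ?_
  rcases le_or_gt (a j) t with h | h
  · exact Finset.notMem_empty j (h1 ▸ Finset.mem_filter.2 ⟨hj, h⟩)
  · exact Finset.notMem_empty j (h2 ▸ Finset.mem_filter.2 ⟨hj, h⟩)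

/-- The work that SRPT has completed by time `X` fits into the time from `t` to `X`. -/
def WorkBound (t : ℝ) (w d : Fin n → ℝ) (U : Finset (Fin n)) : Prop :=
  (∀ i ∈ U, t + w i ≤ d i) ∧ ∀ X, t ≤ X → ∑ i ∈ U with d i ≤ X, w i ≤ X - t

lemma WorkBound.of_later {t t' : ℝ} {w d : Fin n → ℝ} {U : Finset (Fin n)}
    (hw : ∀ i ∈ U, 0 ≤ w i) (ht : t ≤ t') (h : WorkBound t' w d U) : WorkBound t w d U := by
  refine ⟨fun i hi => by linarith [h.1 i hi], fun X hX => ?_⟩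
  rcases lt_or_ge X t' with hX' | hX'
  · rw [Finset.filter_false_of_mem, Finset.sum_empty]
    · linarith
    · intro i hi
      linarith [h.1 i hi, hw i hi]
  · linarith [h.2 X hX']

lemma WorkBound.finish {t : ℝ} {w d : Fin n → ℝ} {U : Finset (Fin n)} {i : Fin n} (hi : i ∈ U)
    (hw : ∀ j ∈ U, 0 ≤ w j) (h : WorkBound (t + w i) w d (U.erase i)) :
    WorkBound t w (Function.update d i (t + w i)) U := by
  have key : ∀ j ∈ U.erase i, t + w i ≤ d j := fun j hj => by
    linarith [h.1 j hj, hw j (Finset.mem_of_mem_erase hj)]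
  refine ⟨fun j hj => ?_, fun X hX => ?_⟩
  · rcases eq_or_ne j i with rfl | hji
    · simp
    · rw [Function.update_of_ne hji]
      linarith [h.1 j (Finset.mem_erase.2 ⟨hji, hj⟩), hw i hi]
  · have hsum : ∑ j ∈ U.erase i with Function.update d i (t + w i) j ≤ X, w j
        = ∑ j ∈ U.erase i with d j ≤ X, w j := by
      refine Finset.sum_congr (Finset.filter_congr fun j hj => ?_) fun _ _ => rfl
      rw [Function.update_of_ne (Finset.ne_of_mem_erase hj)]
    have hfil : ∑ j ∈ U with Function.update d i (t + w i) j ≤ X, w j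
        = (if t + w i ≤ X then w i else 0) + ∑ j ∈ U.erase i with d j ≤ X, w j := by
      rw [← hsum, Finset.sum_filter, Finset.sum_filter, ← Finset.add_sum_erase _ _ hi]
      simp
    rw [hfil]
    split_ifs with hc
    · linarith [h.2 X hc]
    · rw [Finset.filter_false_of_mem, Finset.sum_empty]
      · linarith
      · intro j hj
        linarith [key j hj]

lemma srptRun_workBound (a : Fin n → ℝ) (m : ℕ) :
    ∀ (t : ℝ) (w : Fin n → ℝ) (U : Finset (Fin n)), (∀ i ∈ U, 0 ≤ w i) →
      U.card + (U.filter fun j => t < a j).card ≤ m →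
      WorkBound t w (srptRun a m t w U) U := by
  induction m with
  | zero =>
    intro t w U _ hm
    obtain rfl : U = ∅ := Finset.card_eq_zero.1 (by omega)
    exact ⟨by simp, fun X hX => by simpa using hX⟩
  | succ m ih =>
    intro t w U hw hm
    have finish : ∀ i ∈ U, WorkBound t w
        (Function.update (srptRun a m (t + w i) w (U.erase i)) i (t + w i)) U := fun i hi =>
      .finish hi hw (ih _ _ _ (fun j hj => hw j (Finset.mem_of_mem_erase hj))
        (card_erase_add_card_filter_le hi (by linarith [hw i hi]) hm))
    rcases h1 : firstArgmin (U.filter fun j => a j ≤ t) w with _ | i <;>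
    rcases h2 : firstArgmin (U.filter fun j => t < a j) a with _ | l <;>
    simp only [srptRun, h1, h2]
    · obtain rfl := eq_empty_of_filter_eq_empty (eq_empty_of_firstArgmin h1)
        (eq_empty_of_firstArgmin h2)
      exact ⟨by simp, fun X hX => by simpa using hX⟩
    · obtain ⟨hl, -⟩ := firstArgmin_spec h2
      rw [Finset.mem_filter] at hl
      exact .of_later hw hl.2.le (ih _ _ _ hw (card_add_card_filter_lt hl.1 hl.2 hm))
    · exact finish i (Finset.mem_filter.1 (firstArgmin_spec h1).1).1
    · obtain ⟨hl, -⟩ := firstArgmin_spec h2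
      obtain ⟨hi, -⟩ := firstArgmin_spec h1
      rw [Finset.mem_filter] at hl hi
      split_ifs with hc
      · exact finish i hi.1
      · have hw' : ∀ j ∈ U, 0 ≤ Function.update w i (w i - (a l - t)) j := by
          intro j hj
          rcases eq_or_ne j i with rfl | hji
          · rw [Function.update_self]; linarith
          · rw [Function.update_of_ne hji]; exact hw j hj
        have h := ih (a l) _ U hw' (card_add_card_filter_lt hl.1 hl.2 hm)
        set d := srptRun a m (a l) (Function.update w i (w i - (a l - t))) U
        refine ⟨fun j hj => ?_, fun X hX => ?_⟩
        · have := h.1 j hj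
          rcases eq_or_ne j i with rfl | hji
          · rw [Function.update_self] at this; linarith
          · rw [Function.update_of_ne hji] at this; linarith
        · rcases lt_or_ge X (a l) with hX' | hX'
          · rw [Finset.filter_false_of_mem, Finset.sum_empty]
            · linarith
            · intro j hj
              linarith [h.1 j hj, hw' j hj]
          · have h3 : ∑ j ∈ U with d j ≤ X, w j ≤
                ∑ j ∈ U with d j ≤ X, (Function.update w i (w i - (a l - t)) j
                  + if j = i then a l - t else 0) := by
              refine Finset.sum_le_sum fun j _ => ?_
              rcases eq_or_ne j i with rfl | hji
              · simp
              · simp [hji]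
            have h4 : ∑ j ∈ U with d j ≤ X, (if j = i then a l - t else 0) ≤ a l - t := by
              rw [Finset.sum_ite_eq']
              split_ifs <;> linarith
            rw [Finset.sum_add_distrib] at h3
            linarith [h.2 X hX']

/-- The jobs of `J` can be processed between `t` and `X` by a machine without setup times. -/
def Fits (a : Fin n → ℝ) (t : ℝ) (w : Fin n → ℝ) (J : Finset (Fin n)) (X : ℝ) : Prop :=
  t + ∑ j ∈ J, w j ≤ X ∧ ∀ i ∈ J, t < a i → a i + ∑ j ∈ J with a i ≤ a j, w j ≤ X

lemma Fits.later {a : Fin n → ℝ} {t t' : ℝ} {w : Fin n → ℝ} {J : Finset (Fin n)} {X : ℝ}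
    (h : Fits a t w J X) (hJ : J.Nonempty) (ht : t ≤ t') (hlt : ∀ j ∈ J, t < a j)
    (hle : ∀ j ∈ J, t' ≤ a j) : Fits a t' w J X := by
  refine ⟨?_, fun i hi hti => h.2 i hi (ht.trans_lt hti)⟩
  obtain ⟨i, hi, hmin⟩ := J.exists_min_image a hJ
  have := h.2 i hi (hlt i hi)
  rw [Finset.filter_true_of_mem hmin] at this
  linarith [hle i hi]

lemma Fits.congr {a : Fin n → ℝ} {t : ℝ} {w w' : Fin n → ℝ} {J : Finset (Fin n)} {X : ℝ}
    (h : Fits a t w J X) (hw : ∀ j ∈ J, w' j = w j) : Fits a t w' J X := by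
  refine ⟨by rw [Finset.sum_congr rfl hw]; exact h.1, fun i hi hti => ?_⟩
  rw [Finset.sum_congr rfl fun j hj => hw j (Finset.mem_filter.1 hj).1]
  exact h.2 i hi hti

/-- Both jobs are available at `t`, so the swap leaves every constraint at a later availability time
unchanged and can only lower the total work. -/
lemma Fits.exchange {a : Fin n → ℝ} {t : ℝ} {w : Fin n → ℝ} {J : Finset (Fin n)} {X : ℝ}
    {i j : Fin n} (h : Fits a t w J X) (hj : j ∈ J) (hi : i ∉ J) (hai : a i ≤ t) (haj : a j ≤ t)
    (hij : w i ≤ w j) : Fits a t w (insert i (J.erase j)) X := by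
  have hi' : i ∉ J.erase j := fun h => hi (Finset.mem_of_mem_erase h)
  refine ⟨?_, fun l hl htl => ?_⟩
  · rw [Finset.sum_insert hi']
    have := Finset.add_sum_erase J w hj
    linarith [h.1]
  · have hl' : l ∈ J := by
      rcases Finset.mem_insert.1 hl with rfl | hl
      · exact absurd htl hai.not_gt
      · exact Finset.mem_of_mem_erase hl
    have hset : ((insert i (J.erase j)).filter fun x => a l ≤ a x)
        = J.filter fun x => a l ≤ a x := by
      ext x
      simp only [Finset.mem_filter, Finset.mem_insert, Finset.mem_erase]
      constructor
      · rintro ⟨rfl | hx, hlx⟩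
        · linarith
        · exact ⟨hx.2, hlx⟩
      · rintro ⟨hx, hlx⟩
        refine ⟨Or.inr ⟨?_, hx⟩, hlx⟩
        rintro rfl
        linarith
    rw [hset]
    exact h.2 l hl' htl

lemma card_filter_update {d : Fin n → ℝ} {U : Finset (Fin n)} {i : Fin n} {c X : ℝ}
    (hi : i ∈ U) :
    (U.filter fun j => Function.update d i c j ≤ X).card
      = (if c ≤ X then 1 else 0) + ((U.erase i).filter fun j => d j ≤ X).card := by
  rw [Finset.card_filter, Finset.card_filter, ← Finset.add_sum_erase _ _ hi, Function.update_self]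
  congr 1
  refine Finset.sum_congr rfl fun j hj => ?_
  rw [Function.update_of_ne (Finset.ne_of_mem_erase hj)]

/-- SRPT completes as many jobs as possible by any time `X`. -/
lemma card_le_card_srptRun_le (a : Fin n → ℝ) (m : ℕ) :
    ∀ (t : ℝ) (w : Fin n → ℝ) (U : Finset (Fin n)), (∀ i ∈ U, 0 ≤ w i) →
      U.card + (U.filter fun j => t < a j).card ≤ m → ∀ J ⊆ U, ∀ X, Fits a t w J X →
      J.card ≤ (U.filter fun j => srptRun a m t w U j ≤ X).card := by
  induction m with
  | zero =>
    intro t w U _ hm J hJ X _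
    obtain rfl : U = ∅ := Finset.card_eq_zero.1 (by omega)
    simp [Finset.subset_empty.1 hJ]
  | succ m ih =>
    intro t w U hw hm J hJ X hfit
    -- Running `i ∉ J` does no harm, because no job of `J` becomes available before `i` is finished.
    have finish_idle : ∀ J ⊆ U, J.Nonempty → Fits a t w J X → ∀ i ∈ U, a i ≤ t →
        (∀ j ∈ J, t < a j) → (∀ j ∈ J, t + w i ≤ a j) →
        J.card ≤ (U.filter fun j => Function.update (srptRun a m (t + w i) w (U.erase i)) i
          (t + w i) j ≤ X).card := by
      intro J hJ hne hfit i hi hai hlt hle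
      have hJi : J ⊆ U.erase i := fun j hj => Finset.mem_erase.2
        ⟨by rintro rfl; exact absurd (hlt _ hj) hai.not_gt, hJ hj⟩
      have := ih (t + w i) w (U.erase i) (fun j hj => hw j (Finset.mem_of_mem_erase hj))
        (card_erase_add_card_filter_le hi (by linarith [hw i hi]) hm) J hJi X
        (hfit.later hne (by linarith [hw i hi]) hlt hle)
      rw [card_filter_update hi]
      omega
    have finish : ∀ J ⊆ U, Fits a t w J X → ∀ i, a i ≤ t → i ∈ J →
        J.card ≤ (U.filter fun j => Function.update (srptRun a m (t + w i) w (U.erase i)) i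
          (t + w i) j ≤ X).card := by
      intro J hJ hfit i hai hiJ
      have hi := hJ hiJ
      have hsum := Finset.add_sum_erase J w hiJ
      have hnn : 0 ≤ ∑ j ∈ J.erase i, w j :=
        Finset.sum_nonneg fun j hj => hw j (hJ (Finset.mem_of_mem_erase hj))
      have := ih (t + w i) w (U.erase i) (fun j hj => hw j (Finset.mem_of_mem_erase hj))
        (card_erase_add_card_filter_le hi (by linarith [hw i hi]) hm) (J.erase i)
        (Finset.erase_subset_erase i hJ) X
        ⟨by linarith [hfit.1], fun l hl htl => by
          refine le_trans (add_le_add le_rfl (Finset.sum_le_sum_of_subset_of_nonneg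
            (Finset.filter_subset_filter _ (Finset.erase_subset i J)) fun j hj _ =>
              hw j (hJ (Finset.mem_filter.1 hj).1)))
            (hfit.2 l (Finset.mem_of_mem_erase hl) (by linarith [hw i hi]))⟩
      rw [card_filter_update hi, if_pos (by linarith [hfit.1])]
      have := Finset.card_erase_add_one hiJ
      omega
    rcases J.eq_empty_or_nonempty with rfl | hne
    · simp
    rcases h1 : firstArgmin (U.filter fun j => a j ≤ t) w with _ | i
    · have h1' := eq_empty_of_firstArgmin h1
      rcases h2 : firstArgmin (U.filter fun j => t < a j) a with _ | l <;>
      simp only [srptRun, h1, h2]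
      · obtain rfl := eq_empty_of_filter_eq_empty h1' (eq_empty_of_firstArgmin h2)
        simp [Finset.subset_empty.1 hJ]
      · obtain ⟨hl, hmin⟩ := firstArgmin_spec h2
        rw [Finset.mem_filter] at hl
        have hlt : ∀ j ∈ J, t < a j := fun j hj => by
          by_contra hc
          exact Finset.notMem_empty j (h1' ▸ Finset.mem_filter.2 ⟨hJ hj, not_lt.1 hc⟩)
        exact ih _ _ _ hw (card_add_card_filter_lt hl.1 hl.2 hm) J hJ X
          (hfit.later hne hl.2.le hlt fun j hj =>
            hmin j (Finset.mem_filter.2 ⟨hJ hj, hlt j hj⟩))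
    obtain ⟨hi, himin⟩ := firstArgmin_spec h1
    rw [Finset.mem_filter] at hi
    -- either `i ∈ J` without loss of generality, or no job of `J` is available
    wlog hcase : i ∈ J ∨ ∀ j ∈ J, t < a j generalizing J
    · push Not at hcase
      obtain ⟨hiJ, j, hj, haj⟩ := hcase
      have hcard : (insert i (J.erase j)).card = J.card := by
        rw [Finset.card_insert_of_notMem fun h => hiJ (Finset.mem_of_mem_erase h),
          Finset.card_erase_add_one hj]
      rw [← hcard]
      have hsub : insert i (J.erase j) ⊆ U :=
        Finset.insert_subset hi.1 ((Finset.erase_subset _ _).trans hJ)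
      have hfit' := hfit.exchange hj hiJ hi.2 haj (himin j (Finset.mem_filter.2 ⟨hJ hj, haj⟩))
      exact this _ hsub hfit' (Finset.insert_nonempty _ _) (Or.inl (Finset.mem_insert_self _ _))
    rcases h2 : firstArgmin (U.filter fun j => t < a j) a with _ | l <;>
    simp only [srptRun, h1, h2]
    · have h2' := eq_empty_of_firstArgmin h2
      rcases hcase with hiJ | hlt
      · exact finish J hJ hfit i hi.2 hiJ
      · obtain ⟨j, hj⟩ := hne
        exact absurd (Finset.mem_filter.2 ⟨hJ hj, hlt j hj⟩) (h2' ▸ Finset.notMem_empty j)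
    obtain ⟨hl, hlmin⟩ := firstArgmin_spec h2
    rw [Finset.mem_filter] at hl
    split_ifs with hc
    · rcases hcase with hiJ | hlt
      · exact finish J hJ hfit i hi.2 hiJ
      · exact finish_idle J hJ hne hfit i hi.1 hi.2 hlt fun j hj =>
          hc.trans (hlmin j (Finset.mem_filter.2 ⟨hJ hj, hlt j hj⟩))
    · have hw' : ∀ j ∈ U, 0 ≤ Function.update w i (w i - (a l - t)) j := by
        intro j hj
        rcases eq_or_ne j i with rfl | hji
        · rw [Function.update_self]; linarith
        · rw [Function.update_of_ne hji]; exact hw j hj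
      refine ih _ _ _ hw' (card_add_card_filter_lt hl.1 hl.2 hm) J hJ X ?_
      rcases hcase with hiJ | hlt
      · refine ⟨?_, fun x hx hlx => ?_⟩
        · have h3 := Finset.add_sum_erase J w hiJ
          rw [← Finset.add_sum_erase J _ hiJ, Function.update_self,
            Finset.sum_congr rfl fun j hj =>
              Function.update_of_ne (Finset.ne_of_mem_erase hj) _ _]
          linarith [hfit.1]
        · refine le_of_eq_of_le ?_ (hfit.2 x hx (hl.2.trans hlx))
          congr 1
          refine Finset.sum_congr rfl fun j hj => Function.update_of_ne ?_ _ _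
          rintro rfl
          linarith [(Finset.mem_filter.1 hj).2, hl.2, hi.2]
      · refine (hfit.later hne hl.2.le hlt fun j hj =>
          hlmin j (Finset.mem_filter.2 ⟨hJ hj, hlt j hj⟩)).congr fun j hj => ?_
        refine Function.update_of_ne ?_ _ _
        rintro rfl
        exact absurd (hlt _ hj) hi.2.not_gt

/-! ### GIPP -/

lemma setupTime_nonneg {τ : ℝ} (hτ : 0 ≤ τ) (loc : Option (Fin k)) (v : Fin k) :
    0 ≤ setupTime τ loc v := by
  unfold setupTime; split_ifs <;> simp [hτ]

lemma setupTime_le {τ : ℝ} (hτ : 0 ≤ τ) (loc : Option (Fin k)) (v : Fin k) :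
    setupTime τ loc v ≤ τ := by
  unfold setupTime; split_ifs <;> simp [hτ]

/-- Under GIPP, a job `j` costs at most as much as if the jobs were served in the order of their
availability times `d`, each with a setup. -/
lemma gippRun_le (I : PollingInstance k n) {τ : ℝ} (hτ : 0 ≤ τ) (hw : ∀ i, 0 < I.work i)
    (d : Fin n → ℝ) (m : ℕ) :
    ∀ (t : ℝ) (loc : Option (Fin k)) (U : Finset (Fin n)), 0 ≤ t →
      I.gippRun τ d m t loc U ≤
        ∑ j ∈ U, (max t (d j) + ∑ i ∈ U with d i ≤ d j, (I.work i + τ)) := by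
  have hnn : ∀ (t : ℝ) (U : Finset (Fin n)), 0 ≤ t →
      0 ≤ ∑ j ∈ U, (max t (d j) + ∑ i ∈ U with d i ≤ d j, (I.work i + τ)) := fun t U ht =>
    Finset.sum_nonneg fun j _ => add_nonneg (le_max_of_le_left ht)
      (Finset.sum_nonneg fun i _ => by linarith [hw i])
  induction m with
  | zero => exact fun t loc U ht => hnn t U ht
  | succ m ih =>
    intro t loc U ht
    rcases h1 : firstArgmin U d with _ | j₀
    · simp only [gippRun, h1]
      exact hnn t U ht
    rcases h2 : firstArgmin (U.filter fun i => d i ≤ max t (d j₀))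
      (fun i => -I.gittinsIndex τ loc i) with _ | i
    · simp only [gippRun, h1, h2]
      exact hnn t U ht
    simp only [gippRun, h1, h2]
    obtain ⟨-, hj₀⟩ := firstArgmin_spec h1
    obtain ⟨hi, himin⟩ := firstArgmin_spec h2
    rw [Finset.mem_filter] at hi
    set t₀ := max t (d j₀) with ht₀
    set x := setupTime τ loc (I.queue i) + I.work i with hx
    have hx0 : 0 ≤ x := add_nonneg (setupTime_nonneg hτ _ _) (hw i).le
    have htt₀ : t ≤ t₀ := le_max_left _ _
    have hmax : ∀ j ∈ U, t₀ ≤ max t (d j) := fun j hj => max_le_max le_rfl (hj₀ j hj)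
    -- Largest Gittins index means smallest setup plus workload, so the chosen `x` is at most the
    -- full price of any available job.
    have hxle : ∀ j ∈ U, d j ≤ t₀ → x ≤ I.work j + τ := by
      intro j hj hdj
      have h3 := himin j (Finset.mem_filter.2 ⟨hj, hdj⟩)
      rw [neg_le_neg_iff] at h3
      unfold gittinsIndex at h3
      rw [one_div_le_one_div (add_pos_of_pos_of_nonneg (hw j) (setupTime_nonneg hτ _ _))
        (add_pos_of_pos_of_nonneg (hw i) (setupTime_nonneg hτ _ _))] at h3
      linarith [setupTime_le hτ loc (I.queue j)]
    have hc : t₀ + setupTime τ loc (I.queue i) + I.work i = t₀ + x := by rw [hx]; ring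
    rw [hc]
    have hrec := ih (t₀ + x) (some (I.queue i)) (U.erase i) (by linarith)
    set Q : Fin n → ℝ := fun j => ∑ l ∈ U with d l ≤ d j, (I.work l + τ) with hQ
    -- Serving `i` delays `j` by at most `x`. If `d i ≤ d j`, the term of `i` in `Q j` pays for
    -- this; otherwise `i` has overtaken `j`, and the delay is charged to `Q i`, which contains the
    -- term of `j` (`hfirst`).
    have hstep : ∀ j ∈ U.erase i,
        max (t₀ + x) (d j) + ∑ l ∈ U.erase i with d l ≤ d j, (I.work l + τ) ≤
          max t (d j) + Q j + if d j < d i then x else 0 := by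
      intro j hj
      have hjU := Finset.mem_of_mem_erase hj
      have hsum : Q j = (if d i ≤ d j then I.work i + τ else 0) +
          ∑ l ∈ U.erase i with d l ≤ d j, (I.work l + τ) := by
        simp only [hQ]
        rw [Finset.sum_filter, Finset.sum_filter, ← Finset.add_sum_erase _ _ hi.1]
      have hxi := hxle i hi.1 hi.2
      have hm := hmax j hjU
      have hm' : max (t₀ + x) (d j) ≤ max t (d j) + x :=
        max_le (by linarith) (by linarith [le_max_right t (d j)])
      rcases lt_or_ge (d j) (d i) with hd | hd
      · rw [if_pos hd]
        rw [if_neg hd.not_ge] at hsum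
        linarith
      · rw [if_neg hd.not_gt]
        rw [if_pos hd] at hsum
        linarith
    have hfirst : t₀ + x + ∑ j ∈ U.erase i, (if d j < d i then x else 0) ≤
        max t (d i) + Q i := by
      have h4 : Q i = (I.work i + τ) +
          ∑ l ∈ U.erase i with d l ≤ d i, (I.work l + τ) := by
        simp only [hQ]
        rw [Finset.sum_filter, Finset.sum_filter, ← Finset.add_sum_erase _ _ hi.1, if_pos le_rfl]
      have h5 : ∑ j ∈ U.erase i, (if d j < d i then x else 0) ≤
          ∑ l ∈ U.erase i with d l ≤ d i, (I.work l + τ) := by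
        rw [Finset.sum_filter]
        refine Finset.sum_le_sum fun l hl => ?_
        have hlU := Finset.mem_of_mem_erase hl
        split_ifs with h6 h7 h7
        · exact hxle l hlU (h7.trans hi.2)
        · exact absurd h6.le h7
        · linarith [hw l]
        · exact le_rfl
      linarith [hmax i hi.1, hxle i hi.1 hi.2]
    have hall := (Finset.sum_le_sum hstep).trans_eq Finset.sum_add_distrib
    have hgoal := Finset.add_sum_erase U (fun j => max t (d j) + Q j) hi.1
    simp only [hQ] at hgoal hall hfirst
    linarith

lemma card_add_card_filter_le_two_mul (a : Fin n → ℝ) (t : ℝ) (U : Finset (Fin n)) :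
    U.card + (U.filter fun j => t < a j).card ≤ 2 * n := by
  have h1 := U.card_le_univ
  have h2 := Finset.card_filter_le U fun j => t < a j
  simp only [Fintype.card_fin] at h1
  omega

lemma gippCost_le (I : PollingInstance k n) {τ θ T : ℝ} (hτ : 0 ≤ τ) (hθ : 0 ≤ θ)
    (hw : ∀ i, 0 < I.work i) (hτw : ∀ i, τ ≤ θ * I.work i) (hT : 0 ≤ T)
    (loc : Option (Fin k)) (U : Finset (Fin n)) :
    I.gippCost τ T loc U ≤
      ∑ j ∈ U, ((θ + 2) * I.srptCompletion T U j - (θ + 1) * T) := by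
  obtain ⟨h1, h2⟩ := srptRun_workBound (fun j => max (I.release j) T) (2 * n) T I.work U
    (fun i _ => (hw i).le) (card_add_card_filter_le_two_mul _ _ _)
  refine (I.gippRun_le hτ hw (I.srptCompletion T U) _ T loc U hT).trans
    (Finset.sum_le_sum fun j hj => ?_)
  have hTd : T ≤ I.srptCompletion T U j := by
    have := h1 j hj
    have := hw j
    unfold srptCompletion
    linarith
  have h3 : ∑ i ∈ U with I.srptCompletion T U i ≤ I.srptCompletion T U j, I.work i ≤
    I.srptCompletion T U j - T := h2 _ hTd
  have h4 : ∑ i ∈ U with I.srptCompletion T U i ≤ I.srptCompletion T U j, (I.work i + τ) ≤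
      (1 + θ) * ∑ i ∈ U with I.srptCompletion T U i ≤ I.srptCompletion T U j, I.work i := by
    rw [Finset.mul_sum]
    exact Finset.sum_le_sum fun i _ => by linarith [hτw i]
  rw [max_eq_right hTd]
  nlinarith

/-! ### Offline schedules -/

/-- The job that starts last can only start once all others are finished, so induction on the
starting times applies. -/
lemma IsSchedule.add_sum_le {I : PollingInstance k n} {τ : ℝ} {s : Fin n → ℝ}
    (hs : I.IsSchedule τ s) (hτ : 0 ≤ τ) (hw : ∀ i, 0 < I.work i) {t : ℝ} (B : Finset (Fin n)) :
    ∀ X, t ≤ X → (∀ i ∈ B, t ≤ s i) → (∀ i ∈ B, s i + I.work i ≤ X) →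
      t + ∑ i ∈ B, I.work i ≤ X := by
  induction B using Finset.induction_on_max_value s with
  | empty => intro X h _ _; simpa using h
  | insert a B ha hmax ih =>
    intro X _ ht hX
    rw [Finset.sum_insert ha]
    have h1 := ih (s a) (ht a (Finset.mem_insert_self _ _))
      (fun i hi => ht i (Finset.mem_insert_of_mem hi)) (fun i hi => by
        have hne : i ≠ a := fun h => ha (h ▸ hi)
        have hnn : (0 : ℝ) ≤ if I.queue i = I.queue a then 0 else τ := by
          split_ifs <;> simp [hτ]
        rcases hs.separated i a hne with h | h
        · linarith
        · linarith [hmax i hi, hw a])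
    linarith [hX a (Finset.mem_insert_self _ _)]

/-- The values of `o`, in increasing order. -/
lemma exists_sorted_values (o : Fin n → ℝ) :
    ∃ c : ℕ → ℝ, (∀ m < n, ∃ A : Finset (Fin n), A.card = m + 1 ∧ ∀ i ∈ A, o i ≤ c m) ∧
      ∑ m ∈ Finset.range n, c m = ∑ i, o i := by
  set σ := Tuple.sort o
  refine ⟨fun m => if h : m < n then o (σ ⟨m, h⟩) else 0, fun m hm =>
    ⟨(Finset.Iic ⟨m, hm⟩).map σ.toEmbedding, by simp, fun i hi => ?_⟩, ?_⟩
  · simp only [Finset.mem_map, Finset.mem_Iic, Equiv.coe_toEmbedding] at hi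
    obtain ⟨l, hl, rfl⟩ := hi
    simp only [hm, dif_pos]
    exact Tuple.monotone_sort o hl
  · rw [Finset.sum_range]
    simp only [Fin.is_lt, dif_pos, Fin.eta]
    exact Equiv.sum_comp σ o

/-- By the counting hypothesis the `(j + 1)`-st smallest value is at most `Y j`; the largest value
is matched with the last `Y` and removed. -/
lemma sum_le_sum_range_card {ι : Type*} [DecidableEq ι] (f : ι → ℝ) (Y : ℕ → ℝ) (m : ℕ) :
    ∀ U : Finset ι, U.card = m → (∀ j < m, j + 1 ≤ (U.filter fun i => f i ≤ Y j).card) →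
      ∑ i ∈ U, f i ≤ ∑ j ∈ Finset.range m, Y j := by
  induction m with
  | zero => intro U hU _; simp [Finset.card_eq_zero.1 hU]
  | succ m ih =>
    intro U hU h
    obtain ⟨a, ha, hmax⟩ := U.exists_max_image f (Finset.card_pos.1 (by omega))
    have hcard := Finset.card_erase_add_one ha
    have hfa : f a ≤ Y m := by
      have h1 : U.filter (fun i => f i ≤ Y m) = U :=
        Finset.eq_of_subset_of_card_le (Finset.filter_subset _ _) (by
          have := h m (by omega); omega)
      rw [← h1] at ha
      exact (Finset.mem_filter.1 ha).2
    rw [Finset.sum_range_succ, ← Finset.add_sum_erase U f ha]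
    have := ih (U.erase a) (by omega) (fun j hj => by
      have h2 := h j (by omega)
      by_cases hc : f a ≤ Y j
      · rw [Finset.filter_true_of_mem fun i hi =>
          (hmax i (Finset.mem_of_mem_erase hi)).trans hc]
        omega
      · rwa [Finset.filter_erase, Finset.erase_eq_of_notMem]
        exact fun h => hc (Finset.mem_filter.1 h).2)
    linarith

/-- If GIPP is triggered at a time `T` at which `n - U.card` small jobs have been served, and no
unserved job has waited for too long, then it is competitive on the unserved jobs. -/
lemma gippCost_le_sum_Ico (I : PollingInstance k n) {τ θ T b pmin : ℝ} (hτ : 0 ≤ τ)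
    (hθ : 0 ≤ θ) (hp : 0 < pmin) (hw : ∀ i, pmin ≤ I.work i) (hτp : τ ≤ θ * pmin)
    (hkθ : (k : ℝ) ≤ θ + 1) (hb : b ≤ (θ + 1) * pmin) (hT : 0 ≤ T)
    {s : Fin n → ℝ} (hs : I.IsSchedule τ s) {c : ℕ → ℝ}
    (hc : ∀ m < n, ∃ A : Finset (Fin n), A.card = m + 1 ∧ ∀ i ∈ A, s i + I.work i ≤ c m)
    (loc : Option (Fin k)) (U : Finset (Fin n))
    (htrig : ∀ i ∈ U, T ≤ I.release i + k * τ + ((n - U.card : ℕ) : ℝ) * b) :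
    I.gippCost τ T loc U ≤ ∑ m ∈ Finset.Ico (n - U.card) n, (θ + 2) * c m := by
  have hw0 : ∀ i, 0 < I.work i := fun i => hp.trans_le (hw i)
  have hUn : U.card ≤ n := by simpa using U.card_le_univ
  refine (I.gippCost_le hτ hθ hw0 (fun i => hτp.trans (by nlinarith [hw i])) hT loc U).trans ?_
  rw [Finset.sum_Ico_eq_sum_range, Nat.sub_sub_self hUn]
  refine sum_le_sum_range_card _ _ _ U rfl fun j hj => ?_
  set L := n - U.card with hL
  obtain ⟨A, hAcard, hA⟩ := hc (L + j) (by omega)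
  -- Only `L` jobs lie outside `U`, so at least `j + 1` of the `L + j + 1` jobs of `A` are in `U`.
  obtain ⟨J, hJ, hJcard⟩ : ∃ J ⊆ A ∩ U, J.card = j + 1 := by
    refine Finset.exists_subset_card_eq ?_
    have h1 := Finset.card_union_add_card_inter A U
    have h2 : (A ∪ U).card ≤ n := by simpa using (A ∪ U).card_le_univ
    omega
  have hJA : J ⊆ A := hJ.trans Finset.inter_subset_left
  have hJU : J ⊆ U := hJ.trans Finset.inter_subset_right
  have hne : J.Nonempty := Finset.card_pos.1 (by omega)
  obtain ⟨i₀, hi₀, hmin⟩ := J.exists_min_image I.release hne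
  have hi₀A := hA i₀ (hJA hi₀)
  have hrel : I.release i₀ + ∑ i ∈ J, I.work i ≤ c (L + j) :=
    hs.add_sum_le hτ hw0 J _ (by linarith [hs.release_le i₀, hw0 i₀])
      (fun i hi => (hmin i hi).trans (hs.release_le i)) fun i hi => hA i (hJA hi)
  have hset : τ + (L * pmin + ∑ i ∈ J, I.work i) ≤ c (L + j) := by
    have h1 := hs.add_sum_le (t := τ) hτ hw0 A _ (by linarith [hs.first_setup i₀, hw0 i₀])
      (fun i _ => hs.first_setup i) hA
    rw [← Finset.sum_sdiff hJA] at h1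
    have h2 : (L : ℝ) * pmin ≤ ∑ i ∈ A \ J, I.work i := by
      have h3 := Finset.card_nsmul_le_sum (A \ J) I.work pmin fun i _ => hw i
      rwa [Finset.card_sdiff_of_subset hJA, hAcard, hJcard,
        show L + j + 1 - (j + 1) = L by omega, nsmul_eq_mul] at h3
    linarith
  have hTi := htrig i₀ (hJU hi₀)
  have hLb : (L : ℝ) * b ≤ (θ + 1) * (L * pmin) := by
    have := mul_le_mul_of_nonneg_left hb (Nat.cast_nonneg (α := ℝ) L)
    linarith
  have hkτ : (k : ℝ) * τ ≤ (θ + 1) * τ := mul_le_mul_of_nonneg_right hkθ hτ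
  -- If the maximum is `T` plus the work `W` of `J`, the left side is `T + (θ + 2) * W`. The trigger
  -- condition splits it into `I.release i₀ + W ≤ c (L + j)` and `k * τ + L * b + (θ + 1) * W`,
  -- which is at most `(θ + 1) * c (L + j)` by `hset`.
  have hX : (θ + 2) * max (c (L + j)) (T + ∑ i ∈ J, I.work i) - (θ + 1) * T ≤
      (θ + 2) * c (L + j) := by
    rcases max_cases (c (L + j)) (T + ∑ i ∈ J, I.work i) with ⟨h, -⟩ | ⟨h, -⟩ <;> rw [h]
    · nlinarith
    · have h5 := mul_le_mul_of_nonneg_left hset (by linarith : 0 ≤ θ + 1)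
      linarith
  have hfit : Fits (fun j => max (I.release j) T) T I.work J
      (max (c (L + j)) (T + ∑ i ∈ J, I.work i)) := by
    refine ⟨le_max_right _ _, fun i hi hTi' => le_max_of_le_left ?_⟩
    have hri : max (I.release i) T = I.release i :=
      max_eq_left (le_of_not_ge fun h => hTi'.ne' (max_eq_right h))
    simp only [hri] at hTi' ⊢
    refine hs.add_sum_le hτ hw0 _ _ (by linarith [hs.release_le i, hw0 i, hA i (hJA hi)])
      (fun l hl => ?_) fun l hl => hA l (hJA (Finset.mem_filter.1 hl).1)
    rcases le_max_iff.1 (Finset.mem_filter.1 hl).2 with h | h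
    · exact h.trans (hs.release_le l)
    · exact absurd hTi' h.not_gt
  have hcount := card_le_card_srptRun_le (fun j => max (I.release j) T) (2 * n) T I.work U
    (fun i _ => (hw0 i).le) (card_add_card_filter_le_two_mul _ _ _) J hJU _ hfit
  rw [hJcard] at hcount
  refine hcount.trans (Finset.card_le_card fun i hi => ?_)
  rw [Finset.mem_filter] at hi ⊢
  refine ⟨hi.1, ?_⟩
  have := mul_le_mul_of_nonneg_left hi.2 (by linarith : 0 ≤ θ + 2)
  unfold srptCompletion
  linarith

/-! ### The cyclic phase of the mixed strategy -/

/-- A bound for the number of setups that precede the arrival of the server at `loc`, counted from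
the arrival of a job in queue `v` that is still waiting. -/
def setupsUsed : Option (Fin k) → Fin k → ℕ
  | none, _ => 0
  | some c, v => k - cyclicDist (some c) v

lemma cyclicDist_some (c v : Fin k) :
    cyclicDist (some c) v = if c ≤ v then (v : ℕ) - c else v + k - c := by
  have := v.2
  have := c.2
  simp only [cyclicDist, Fin.le_def]
  split_ifs with h
  · rw [Nat.mod_eq_sub_mod (by omega), Nat.mod_eq_of_lt (by omega)]
    omega
  · exact Nat.mod_eq_of_lt (by omega)

lemma setupsUsed_le (loc : Option (Fin k)) (v : Fin k) : setupsUsed loc v ≤ k := by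
  cases loc <;> simp [setupsUsed]

lemma one_le_setupsUsed (c v : Fin k) : 1 ≤ setupsUsed (some c) v := by
  have := v.2
  have := c.2
  rw [setupsUsed, cyclicDist_some]
  split_ifs with h <;> rw [Fin.le_def] at h <;> omega

/-- Moving to the nearest non-empty queue never jumps over `u`, so the remaining distance to `u`
drops by at least one. -/
lemma setupsUsed_succ_le {loc : Option (Fin k)} {u v : Fin k}
    (h : cyclicDist loc v ≤ cyclicDist loc u) (hv : loc ≠ some v) :
    setupsUsed loc u + 1 ≤ setupsUsed (some v) u := by
  cases loc with
  | none => simpa [setupsUsed] using one_le_setupsUsed v u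
  | some c =>
    have h1 := v.2
    have h2 := c.2
    have h3 := u.2
    have hcv : (c : ℕ) ≠ v := fun h => hv (congrArg some (Fin.ext h))
    simp only [setupsUsed, cyclicDist_some, Fin.le_def] at h ⊢
    split_ifs at h ⊢ <;> omega

lemma setupTime_add_setupsUsed_mul_le {τ : ℝ} (hτ : 0 ≤ τ) {loc : Option (Fin k)} {u v : Fin k}
    (h : cyclicDist loc v ≤ cyclicDist loc u) :
    setupTime τ loc v + setupsUsed loc u * τ ≤ setupsUsed (some v) u * τ := by
  unfold setupTime
  split_ifs with hv
  · rw [hv, zero_add]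
  · have h1 : (setupsUsed loc u : ℝ) + 1 ≤ setupsUsed (some v) u := by
      exact_mod_cast setupsUsed_succ_le h hv
    nlinarith

/-- The invariant bounds the time a waiting job has spent by its setups plus `L * b` for all
services so far; it also implies the trigger condition required by `hgipp`. The sign of `L * b` is
carried along because `b` may be negative before any small job has been seen. -/
lemma mixedRun_le_sum_Ico (I : PollingInstance k n) {τ b pmin K : ℝ} (hτ : 0 ≤ τ)
    (hr : ∀ i, 0 ≤ I.release i) (hp : 0 < pmin) (hw : ∀ i, pmin ≤ I.work i)
    (hkK : (k : ℝ) ≤ K - 1) (hbK : b ≤ (K - 1) * pmin)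
    {s : Fin n → ℝ} (hs : I.IsSchedule τ s) {c : ℕ → ℝ}
    (hc : ∀ m < n, ∃ A : Finset (Fin n), A.card = m + 1 ∧ ∀ i ∈ A, s i + I.work i ≤ c m)
    (hgipp : (∃ i, b < I.work i) → ∀ (T : ℝ) (loc : Option (Fin k)) (U : Finset (Fin n)), 0 ≤ T →
      (∀ i ∈ U, T ≤ I.release i + k * τ + ((n - U.card : ℕ) : ℝ) * b) →
      I.gippCost τ T loc U ≤ ∑ m ∈ Finset.Ico (n - U.card) n, K * c m) (m : ℕ) :
    ∀ (t : ℝ) (loc : Option (Fin k)) (U : Finset (Fin n)), 0 ≤ t →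
      0 ≤ ((n - U.card : ℕ) : ℝ) * b →
      (∀ i ∈ U, t ≤ I.release i + setupsUsed loc (I.queue i) * τ +
        ((n - U.card : ℕ) : ℝ) * b) →
      I.mixedRun τ b m t loc U ≤ ∑ m ∈ Finset.Ico (n - U.card) n, K * c m := by
  have hw0 : ∀ i, 0 < I.work i := fun i => hp.trans_le (hw i)
  have hK : 1 ≤ K := by linarith [(Nat.cast_nonneg k : (0 : ℝ) ≤ k)]
  have hset : ∀ m < n, τ + ((m : ℝ) + 1) * pmin ≤ c m := by
    intro m hm
    obtain ⟨A, hAcard, hA⟩ := hc m hm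
    obtain ⟨i, hi⟩ : A.Nonempty := Finset.card_pos.1 (by omega)
    have h1 := hs.add_sum_le (t := τ) hτ hw0 A (c m)
      (by linarith [hs.first_setup i, hw0 i, hA i hi]) (fun i _ => hs.first_setup i) hA
    have h3 := Finset.card_nsmul_le_sum A I.work pmin fun i _ => hw i
    rw [hAcard, nsmul_eq_mul] at h3
    push_cast at h3
    linarith
  have hnn : ∀ l, 0 ≤ ∑ m ∈ Finset.Ico l n, K * c m := fun l =>
    Finset.sum_nonneg fun m hm => mul_nonneg (by linarith)
      ((by positivity : 0 ≤ τ + ((m : ℝ) + 1) * pmin).trans (hset m (Finset.mem_Ico.1 hm).2))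
  induction m with
  | zero => exact fun _ _ _ _ _ _ => hnn _
  | succ m ih =>
    intro t loc U ht hLb hinv
    have hUn : U.card ≤ n := by simpa using U.card_le_univ
    rcases h1 : firstArgmin U I.release with _ | j
    · simp only [mixedRun, h1]
      exact hnn _
    obtain ⟨-, hj⟩ := firstArgmin_spec h1
    simp only [mixedRun, h1]
    set t₀ := max t (I.release j) with ht₀
    set L := n - U.card with hL
    have hkN : ∀ (loc : Option (Fin k)) (v : Fin k), (setupsUsed loc v : ℝ) * τ ≤ k * τ :=
      fun loc v => mul_le_mul_of_nonneg_right (by exact_mod_cast setupsUsed_le loc v) hτ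
    have ht₀0 : 0 ≤ t₀ := ht.trans (le_max_left _ _)
    have hinv₀ : ∀ i ∈ U, t₀ ≤ I.release i + setupsUsed loc (I.queue i) * τ + L * b := by
      intro i hi
      have : 0 ≤ (setupsUsed loc (I.queue i) : ℝ) * τ := by positivity
      exact max_le (hinv i hi) (by linarith [hj i hi])
    split_ifs with hlarge
    · obtain ⟨i, -, hi, -⟩ := hlarge
      exact hgipp ⟨i, hi⟩ t₀ loc U ht₀0 fun i hi => by
        linarith [hinv₀ i hi, hkN loc (I.queue i)]
    push Not at hlarge
    rcases h2 : firstArgmin (U.filter fun i => I.release i ≤ t₀)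
        (fun i => (cyclicDist loc (I.queue i) : ℝ)) with _ | a
    · exact hnn _
    obtain ⟨ha, hamin⟩ := firstArgmin_spec h2
    rw [Finset.mem_filter] at ha
    -- The present job `a` has positive workload and is not large.
    have hb : 0 < b := by
      by_contra hb
      exact (hlarge a ha.1 (by linarith [hw0 a])).not_ge ha.2
    simp only
    set v := I.queue a with hv
    set S := t₀ + setupTime τ loc v with hS
    -- For a job present at `t₀` the setup is counted by the increase of `setupsUsed`; a job
    -- arriving later has waited at most `τ`, and `setupsUsed (some v)` is at least one.
    have hinvS : ∀ i ∈ U, S ≤ I.release i + setupsUsed (some v) (I.queue i) * τ + L * b := by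
      intro i hi
      rcases le_or_gt (I.release i) t₀ with h | h
      · have h3 := hamin i (Finset.mem_filter.2 ⟨hi, h⟩)
        have h4 := setupTime_add_setupsUsed_mul_le hτ (Nat.cast_le.1 h3)
        linarith [hinv₀ i hi]
      · have h3 : (1 : ℝ) ≤ setupsUsed (some v) (I.queue i) := by
          exact_mod_cast one_le_setupsUsed v (I.queue i)
        nlinarith [setupTime_le hτ loc v]
    rcases h3 : firstArgmin (U.filter fun i => b < I.work i ∧ I.release i ≤ S)
      I.release with _ | l
    swap
    · obtain ⟨hl, -⟩ := firstArgmin_spec h3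
      rw [Finset.mem_filter] at hl
      exact hgipp ⟨l, hl.2.1⟩ _ loc U (hr l) fun i hi => by
        linarith [hinvS i hi, hkN (some v) (I.queue i)]
    have hsmall := eq_empty_of_firstArgmin h3
    simp only
    rcases h4 : firstArgmin (U.filter fun i => I.queue i = v ∧ I.release i ≤ S)
      I.work with _ | i
    · exact hnn _
    obtain ⟨hi, -⟩ := firstArgmin_spec h4
    rw [Finset.mem_filter] at hi
    simp only
    have hib : I.work i ≤ b := by
      by_contra hc
      exact Finset.notMem_empty i (hsmall ▸ Finset.mem_filter.2 ⟨hi.1, not_le.1 hc, hi.2.2⟩)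
    have hcard := Finset.card_erase_add_one hi.1
    have hL' : n - (U.erase i).card = L + 1 := by omega
    have hLn : L < n := by omega
    have hS0 : 0 ≤ S := add_nonneg ht₀0 (setupTime_nonneg hτ _ _)
    have hrec := ih (S + I.work i) (some v) (U.erase i) (by linarith [hw0 i])
      (by rw [hL']; positivity) (fun j hj => by
        rw [hL']
        push_cast
        linarith [hinvS j (Finset.mem_of_mem_erase hj)])
    rw [hL'] at hrec
    rw [Finset.sum_eq_sum_Ico_succ_bot hLn]
    refine add_le_add ?_ hrec
    obtain ⟨A, hAcard, hA⟩ := hc L hLn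
    -- Only `L` jobs have been served, so one of the `L + 1` jobs finished offline by `c L` is still
    -- waiting or yet to arrive.
    obtain ⟨x, hx⟩ : (A ∩ U).Nonempty := by
      refine Finset.card_pos.1 ?_
      have h5 := Finset.card_union_add_card_inter A U
      have h6 : (A ∪ U).card ≤ n := by simpa using (A ∪ U).card_le_univ
      omega
    rw [Finset.mem_inter] at hx
    have h7 : I.release x ≤ c L := by linarith [hs.release_le x, hA x hx.1, hw0 x]
    have h8 := mul_le_mul_of_nonneg_left (hset L hLn) (by linarith : 0 ≤ K - 1)
    have h9 := mul_le_mul_of_nonneg_right hkK hτ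
    have h10 := mul_le_mul_of_nonneg_left hbK (by positivity : (0 : ℝ) ≤ L + 1)
    linarith [hinvS x hx.2, hkN (some v) (I.queue x)]

/-! ### Comparison with the offline optimum -/

lemma exists_isSchedule (I : PollingInstance k n) {τ : ℝ} (hτ : 0 ≤ τ)
    (hr : ∀ i, 0 ≤ I.release i) (hw : ∀ i, 0 < I.work i) : ∃ s, I.IsSchedule τ s := by
  have hR : ∀ i, I.release i ≤ ∑ j, I.release j := fun i =>
    Finset.single_le_sum (fun j _ => hr j) (Finset.mem_univ i)
  have hW : ∀ i, I.work i ≤ ∑ j, I.work j := fun i =>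
    Finset.single_le_sum (fun j _ => (hw j).le) (Finset.mem_univ i)
  set R := ∑ j, I.release j
  set W := ∑ j, I.work j
  have hW0 : 0 ≤ W := Finset.sum_nonneg fun j _ => (hw j).le
  have hR0 : 0 ≤ R := Finset.sum_nonneg fun j _ => hr j
  have hlt : ∀ i j : Fin n, i < j →
      R + τ + (i : ℕ) * (W + τ) + I.work i + τ ≤ R + τ + (j : ℕ) * (W + τ) := by
    intro i j hij
    have h1 : ((i : ℕ) : ℝ) + 1 ≤ ((j : ℕ) : ℝ) := by exact_mod_cast hij
    have h2 := mul_le_mul_of_nonneg_right h1 (by positivity : 0 ≤ W + τ)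
    linarith [hW i]
  have hnn : ∀ i : Fin n, 0 ≤ ((i : ℕ) : ℝ) * (W + τ) := fun i => by positivity
  refine ⟨fun i => R + τ + (i : ℕ) * (W + τ), fun i => by linarith [hR i, hnn i],
    fun i => by linarith [hnn i], fun i j hij => ?_⟩
  have hite : (if I.queue i = I.queue j then 0 else τ) ≤ τ := by split_ifs <;> simp [hτ]
  rcases lt_or_gt_of_ne hij with h | h
  · left; linarith [hlt i j h]
  · right; linarith [hlt j i h]

/-- The mixed strategy is competitive with any factor `K` that exceeds `max k (b / pmin)` by one
and, in the presence of large jobs, is equal to `θ + 2`. -/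
lemma mixedCost_le_mul_optCost (I : PollingInstance k n) {τ θ b pmin K : ℝ} (hτ : 0 ≤ τ)
    (hθ : 0 ≤ θ) (hr : ∀ i, 0 ≤ I.release i) (hp : 0 < pmin) (hw : ∀ i, pmin ≤ I.work i)
    (hτp : τ ≤ θ * pmin) (hkK : (k : ℝ) ≤ K - 1) (hbK : b ≤ (K - 1) * pmin)
    (hK : (∀ i, I.work i ≤ b) ∨ K = θ + 2) :
    I.mixedCost τ b ≤ K * I.optCost τ := by
  have hw0 : ∀ i, 0 < I.work i := fun i => hp.trans_le (hw i)
  have hK0 : 0 < K := by linarith [(Nat.cast_nonneg k : (0 : ℝ) ≤ k)]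
  obtain ⟨s₀, hs₀⟩ := I.exists_isSchedule hτ hr hw0
  rw [mul_comm, ← div_le_iff₀ hK0]
  refine le_csInf ⟨_, s₀, hs₀, rfl⟩ ?_
  rintro _ ⟨s, hs, rfl⟩
  rw [div_le_iff₀ hK0]
  obtain ⟨c, hc, hsum⟩ := exists_sorted_values fun i => s i + I.work i
  have h := I.mixedRun_le_sum_Ico (b := b) hτ hr hp hw hkK hbK hs hc
    (fun ⟨i, hi⟩ T loc U hT htrig => by
      -- GIPP can be triggered only by a large job, so without large jobs its bound is not needed
      -- and `K` is unrelated to `θ`.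
      rcases hK with hK | rfl
      · exact absurd (hK i) hi.not_ge
      · exact I.gippCost_le_sum_Ico hτ hθ hp hw hτp (by linarith)
          (hbK.trans_eq (by ring)) hT hs hc loc U htrig)
    n 0 none Finset.univ le_rfl (by simp) (fun i _ => by simpa [setupsUsed] using hr i)
  rw [← hsum, mul_comm, Finset.mul_sum, Finset.range_eq_Ico]
  rwa [Finset.card_univ, Fintype.card_fin, Nat.sub_self] at h

lemma gippRun_nonneg (I : PollingInstance k n) {τ : ℝ} (hτ : 0 ≤ τ) (hw : ∀ i, 0 < I.work i)
    (d : Fin n → ℝ) (m : ℕ) : ∀ (t : ℝ) (loc : Option (Fin k)) (U : Finset (Fin n)), 0 ≤ t →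
      0 ≤ I.gippRun τ d m t loc U := by
  induction m with
  | zero => exact fun _ _ _ _ => le_rfl
  | succ m ih =>
    intro t loc U ht
    rw [gippRun]
    split
    · exact le_rfl
    · simp only
      split
      · exact le_rfl
      · rename_i j _ _ i _
        have h1 := setupTime_nonneg hτ loc (I.queue i)
        have h2 := le_max_left t (d j)
        have h3 := hw i
        have h4 : 0 ≤ max t (d j) + setupTime τ loc (I.queue i) + I.work i := by linarith
        exact add_nonneg h4 (ih _ _ _ h4)

lemma mixedRun_nonneg (I : PollingInstance k n) {τ b : ℝ} (hτ : 0 ≤ τ)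
    (hr : ∀ i, 0 ≤ I.release i) (hw : ∀ i, 0 < I.work i) (m : ℕ) :
    ∀ (t : ℝ) (loc : Option (Fin k)) (U : Finset (Fin n)), 0 ≤ t →
      0 ≤ I.mixedRun τ b m t loc U := by
  induction m with
  | zero => exact fun _ _ _ _ => le_rfl
  | succ m ih =>
    intro t loc U ht
    rw [mixedRun]
    split
    · exact le_rfl
    rename_i j _
    have h2 : 0 ≤ max t (I.release j) := le_max_of_le_left ht
    simp only
    split_ifs
    · exact I.gippRun_nonneg hτ hw _ _ _ _ _ h2
    split
    · exact le_rfl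
    rename_i a _
    split
    · exact I.gippRun_nonneg hτ hw _ _ _ _ _ (hr _)
    split
    · exact le_rfl
    rename_i i _
    have h1 := setupTime_nonneg hτ loc (I.queue a)
    have h3 := hw i
    have h4 : 0 ≤ max t (I.release j) + setupTime τ loc (I.queue a) + I.work i := by linarith
    exact add_nonneg h4 (ih _ _ _ h4)

lemma optCost_nonneg (I : PollingInstance k n) {τ : ℝ} (hr : ∀ i, 0 ≤ I.release i)
    (hw : ∀ i, 0 < I.work i) : 0 ≤ I.optCost τ := by
  refine Real.sInf_nonneg ?_
  rintro _ ⟨s, hs, rfl⟩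
  exact Finset.sum_nonneg fun i _ => by linarith [hr i, hs.release_le i, hw i]

/-! ### Measurability -/

section Measurability

variable {α β : Type*} [MeasurableSpace α] [MeasurableSpace β]

/-- The minimiser depends only on a vector of finitely many Booleans, each measurable in `x`, so `G`
may be treated separately for each of its finitely many values. -/
lemma measurable_comp_firstArgmin {S : α → Finset (Fin n)} {f : α → Fin n → ℝ}
    (hS : ∀ i, MeasurableSet {x | i ∈ S x}) (hf : ∀ i, Measurable fun x => f x i)
    {G : Option (Fin n) → α → β} (hG : ∀ o, Measurable (G o)) :
    Measurable fun x => G (firstArgmin (S x) (f x)) x := by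
  have hΦ : Measurable fun x (i : Fin n) => decide (i ∈ S x ∧ ∀ j ∈ S x, f x i ≤ f x j) := by
    refine measurable_pi_lambda _ fun i => measurable_to_bool ?_
    have : (fun x => decide (i ∈ S x ∧ ∀ j ∈ S x, f x i ≤ f x j)) ⁻¹' {true}
        = {x | i ∈ S x} ∩ ⋂ j, ({x | j ∈ S x}ᶜ ∪ {x | f x i ≤ f x j}) := by
      ext x
      simp [imp_iff_not_or]
    rw [this]
    exact (hS i).inter (.iInter fun j => (hS j).compl.union (measurableSet_le (hf i) (hf j)))
  have hF : Measurable fun y : (Fin n → Bool) × α => G ((List.finRange n).find? y.1) y.2 :=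
    measurable_from_prod_countable_right fun b => hG ((List.finRange n).find? b)
  exact hF.comp (hΦ.prodMk measurable_id)

lemma measurableSet_mem_filter_le {U : Finset (Fin n)} {f g : α → Fin n → ℝ}
    (hf : ∀ i, Measurable fun x => f x i) (hg : ∀ i, Measurable fun x => g x i) (i : Fin n) :
    MeasurableSet {x | i ∈ U.filter fun j => f x j ≤ g x j} := by
  simp only [Finset.mem_filter]
  exact (MeasurableSet.const _).inter (measurableSet_le (hf i) (hg i))

lemma measurableSet_mem_filter_lt {U : Finset (Fin n)} {f g : α → Fin n → ℝ}
    (hf : ∀ i, Measurable fun x => f x i) (hg : ∀ i, Measurable fun x => g x i) (i : Fin n) :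
    MeasurableSet {x | i ∈ U.filter fun j => f x j < g x j} := by
  simp only [Finset.mem_filter]
  exact (MeasurableSet.const _).inter (measurableSet_lt (hf i) (hg i))

lemma measurable_update_apply {f : α → Fin n → ℝ} {g : α → ℝ}
    (hf : ∀ i, Measurable fun x => f x i) (hg : Measurable g) (i j : Fin n) :
    Measurable fun x => Function.update (f x) i (g x) j := by
  rcases eq_or_ne j i with rfl | h
  · simpa using hg
  · simpa [Function.update_of_ne h] using hf j

lemma measurable_srptRun {a : α → Fin n → ℝ} (ha : ∀ i, Measurable fun x => a x i) (m : ℕ) :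
    ∀ {t : α → ℝ} {w : α → Fin n → ℝ} (_ : Measurable t) (_ : ∀ i, Measurable fun x => w x i)
      (U : Finset (Fin n)) (j : Fin n), Measurable fun x => srptRun (a x) m (t x) (w x) U j := by
  induction m with
  | zero => intro t w _ _ U j; exact measurable_const
  | succ m ih =>
    intro t w ht hw U j
    have hfin : ∀ i, Measurable fun x => Function.update
        (srptRun (a x) m (t x + w x i) (w x) (U.erase i)) i (t x + w x i) j := fun i =>
      measurable_update_apply (ih (ht.add (hw i)) hw _) (ht.add (hw i)) i j
    simp only [srptRun]
    refine measurable_comp_firstArgmin (f := w)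
      (G := fun o x => (match o, firstArgmin (U.filter fun j => t x < a x j) (a x) with
        | none, none => fun _ => 0
        | none, some l => srptRun (a x) m (a x l) (w x) U
        | some i, none =>
            Function.update (srptRun (a x) m (t x + w x i) (w x) (U.erase i)) i (t x + w x i)
        | some i, some l =>
            if t x + w x i ≤ a x l then
              Function.update (srptRun (a x) m (t x + w x i) (w x) (U.erase i)) i (t x + w x i)
            else
              srptRun (a x) m (a x l) (Function.update (w x) i (w x i - (a x l - t x))) U :
              Fin n → ℝ) j)
      (measurableSet_mem_filter_le ha fun _ => ht) hw fun o => ?_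
    refine measurable_comp_firstArgmin (f := a)
      (G := fun o' x => (match o, o' with
        | none, none => fun _ => 0
        | none, some l => srptRun (a x) m (a x l) (w x) U
        | some i, none =>
            Function.update (srptRun (a x) m (t x + w x i) (w x) (U.erase i)) i (t x + w x i)
        | some i, some l =>
            if t x + w x i ≤ a x l then
              Function.update (srptRun (a x) m (t x + w x i) (w x) (U.erase i)) i (t x + w x i)
            else
              srptRun (a x) m (a x l) (Function.update (w x) i (w x i - (a x l - t x))) U :
              Fin n → ℝ) j)
      (measurableSet_mem_filter_lt (fun _ => ht) ha) ha fun o' => ?_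
    rcases o with _ | i <;> rcases o' with _ | l <;> simp only
    · exact measurable_const
    · exact ih (ha l) hw U j
    · exact hfin i
    · simp only [apply_ite (fun f : Fin n → ℝ => f j)]
      exact Measurable.ite (measurableSet_le (ht.add (hw i)) (ha l)) (hfin i)
        (ih (ha l) (measurable_update_apply hw ((hw i).sub ((ha l).sub ht)) i) U j)

variable {r : Fin n → ℝ} {q : Fin n → Fin k} {w : α → Fin n → ℝ} {τ b : ℝ}

lemma measurable_gippRun (hw : ∀ i, Measurable fun x => w x i) {d : α → Fin n → ℝ}
    (hd : ∀ i, Measurable fun x => d x i) (m : ℕ) :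
    ∀ {t : α → ℝ} (_ : Measurable t) (loc : Option (Fin k)) (U : Finset (Fin n)),
      Measurable fun x => gippRun ⟨r, q, w x⟩ τ (d x) m (t x) loc U := by
  induction m with
  | zero => intro t _ loc U; exact measurable_const
  | succ m ih =>
    intro t ht loc U
    simp only [gippRun]
    refine measurable_comp_firstArgmin (S := fun _ => U) (f := d)
      (G := fun o x => match o with
        | none => (0 : ℝ)
        | some j =>
          match firstArgmin (U.filter fun i => d x i ≤ max (t x) (d x j))
              (fun i => -gittinsIndex ⟨r, q, w x⟩ τ loc i) with
          | none => (0 : ℝ)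
          | some i => max (t x) (d x j) + setupTime τ loc (q i) + w x i +
              gippRun ⟨r, q, w x⟩ τ (d x) m
                (max (t x) (d x j) + setupTime τ loc (q i) + w x i) (some (q i)) (U.erase i))
      (fun _ => .const _) hd fun o => ?_
    rcases o with _ | j
    · exact measurable_const
    have ht₀ : Measurable fun x => max (t x) (d x j) := ht.max (hd j)
    refine measurable_comp_firstArgmin (f := fun x i => -gittinsIndex ⟨r, q, w x⟩ τ loc i)
      (G := fun o x => match o with
        | none => (0 : ℝ)
        | some i => max (t x) (d x j) + setupTime τ loc (q i) + w x i +
            gippRun ⟨r, q, w x⟩ τ (d x) m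
              (max (t x) (d x j) + setupTime τ loc (q i) + w x i) (some (q i)) (U.erase i))
      (measurableSet_mem_filter_le hd fun _ => ht₀)
      (fun i => (Measurable.div measurable_const ((hw i).add_const (setupTime τ loc (q i)))).neg)
      fun o => ?_
    rcases o with _ | i
    · exact measurable_const
    · have hc := (ht₀.add_const (setupTime τ loc (q i))).add (hw i)
      exact hc.add (ih hc _ _)

lemma measurable_gippCost (hw : ∀ i, Measurable fun x => w x i) {t : α → ℝ} (ht : Measurable t)
    (loc : Option (Fin k)) (U : Finset (Fin n)) :
    Measurable fun x => gippCost ⟨r, q, w x⟩ τ (t x) loc U :=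
  measurable_gippRun hw
    (measurable_srptRun (fun _ => measurable_const.max ht) (2 * n) ht hw U) _ ht loc U

lemma measurable_mixedRun (hw : ∀ i, Measurable fun x => w x i) (m : ℕ) :
    ∀ {t : α → ℝ} (_ : Measurable t) (loc : Option (Fin k)) (U : Finset (Fin n)),
      Measurable fun x => mixedRun ⟨r, q, w x⟩ τ b m (t x) loc U := by
  induction m with
  | zero => intro t _ loc U; exact measurable_const
  | succ m ih =>
    intro t ht loc U
    -- Release times are deterministic, so this choice does not depend on `x`.
    rcases h1 : firstArgmin U r with _ | j
    · simp only [mixedRun, h1]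
      exact measurable_const
    simp only [mixedRun, h1]
    have ht₀ : Measurable fun x => max (t x) (r j) := ht.max measurable_const
    refine Measurable.ite ?_ (measurable_gippCost hw ht₀ loc U) ?_
    · have : {x | ∃ i ∈ U, b < w x i ∧ r i ≤ max (t x) (r j)} =
          ⋃ i ∈ U, ({x | b < w x i} ∩ {x | r i ≤ max (t x) (r j)}) := by
        ext x
        simp only [Set.mem_ofPred_eq, Set.mem_iUnion, Set.mem_inter_iff, exists_prop]
      rw [this]
      exact .biUnion U.countable_toSet fun i _ =>
        (measurableSet_lt measurable_const (hw i)).inter (measurableSet_le measurable_const ht₀)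
    refine measurable_comp_firstArgmin (f := fun _ i => (cyclicDist loc (q i) : ℝ))
      (G := fun o x => match o with
        | none => (0 : ℝ)
        | some a =>
          match firstArgmin (U.filter fun i => b < w x i ∧
              r i ≤ max (t x) (r j) + setupTime τ loc (q a)) r with
          | some l => gippCost ⟨r, q, w x⟩ τ (r l) loc U
          | none =>
            match firstArgmin (U.filter fun i => q i = q a ∧
                r i ≤ max (t x) (r j) + setupTime τ loc (q a)) (w x) with
            | none => (0 : ℝ)
            | some i => max (t x) (r j) + setupTime τ loc (q a) + w x i +
                mixedRun ⟨r, q, w x⟩ τ b m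
                  (max (t x) (r j) + setupTime τ loc (q a) + w x i) (some (q a)) (U.erase i))
      (measurableSet_mem_filter_le (f := fun _ => r) (fun _ => measurable_const) fun _ => ht₀)
      (fun _ => measurable_const) fun o => ?_
    rcases o with _ | a
    · exact measurable_const
    have hs : Measurable fun x => max (t x) (r j) + setupTime τ loc (q a) := ht₀.add_const _
    refine measurable_comp_firstArgmin (f := fun _ => r)
      (G := fun o x => match o with
        | some l => gippCost ⟨r, q, w x⟩ τ (r l) loc U
        | none =>
          match firstArgmin (U.filter fun i => q i = q a ∧
              r i ≤ max (t x) (r j) + setupTime τ loc (q a)) (w x) with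
          | none => (0 : ℝ)
          | some i => max (t x) (r j) + setupTime τ loc (q a) + w x i +
              mixedRun ⟨r, q, w x⟩ τ b m
                (max (t x) (r j) + setupTime τ loc (q a) + w x i) (some (q a)) (U.erase i))
      (fun i => ?_) (fun _ => measurable_const) fun o => ?_
    · simp only [Finset.mem_filter]
      exact (MeasurableSet.const _).inter ((measurableSet_lt measurable_const (hw i)).inter
        (measurableSet_le measurable_const hs))
    rcases o with _ | l
    swap
    · exact measurable_gippCost hw measurable_const loc U
    refine measurable_comp_firstArgmin (f := w)
      (G := fun o x => match o with
        | none => (0 : ℝ)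
        | some i => max (t x) (r j) + setupTime τ loc (q a) + w x i +
            mixedRun ⟨r, q, w x⟩ τ b m
              (max (t x) (r j) + setupTime τ loc (q a) + w x i) (some (q a)) (U.erase i))
      (fun i => ?_) hw fun o => ?_
    · simp only [Finset.mem_filter]
      exact (MeasurableSet.const _).inter ((MeasurableSet.const _).inter
        (measurableSet_le measurable_const hs))
    rcases o with _ | i
    · exact measurable_const
    · have hc := hs.add (hw i)
      exact hc.add (ih hc _ _)

end Measurability

/-! ### Measurability of the optimal cost -/

/-- Multiplying all starting times by `l` makes room for the longer workloads and keeps releases and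
setups feasible. This gives upper semicontinuity of the optimal cost on the positive orthant. -/
lemma optCost_le_mul {τ : ℝ} (hτ : 0 ≤ τ) {r : Fin n → ℝ} (hr : ∀ i, 0 ≤ r i)
    {q : Fin n → Fin k} {w w' : Fin n → ℝ} (hw : ∀ i, 0 < w i) (hw' : ∀ i, 0 < w' i) {l : ℝ}
    (hl : 1 ≤ l) (hle : ∀ i, w' i ≤ l * w i) :
    optCost ⟨r, q, w'⟩ τ ≤ l * optCost ⟨r, q, w⟩ τ := by
  have hl0 : 0 < l := by linarith
  obtain ⟨s₀, hs₀⟩ := exists_isSchedule ⟨r, q, w⟩ hτ hr hw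
  rw [mul_comm, ← div_le_iff₀ hl0]
  refine le_csInf ⟨_, s₀, hs₀, rfl⟩ ?_
  rintro _ ⟨s, hs, rfl⟩
  rw [div_le_iff₀ hl0]
  have hs' : ∀ i, s i ≤ l * s i := fun i =>
    le_mul_of_one_le_left ((hr i).trans (hs.release_le i)) hl
  have hls : IsSchedule ⟨r, q, w'⟩ τ fun i => l * s i := by
    refine ⟨fun i => (hs.release_le i).trans (hs' i), fun i => (hs.first_setup i).trans (hs' i),
      fun i j hij => ?_⟩
    have h0 : (0 : ℝ) ≤ if q i = q j then 0 else τ := by split_ifs <;> simp [hτ]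
    have h1 := le_mul_of_one_le_left h0 hl
    rcases hs.separated i j hij with h | h
    · left
      have := mul_le_mul_of_nonneg_left h hl0.le
      simp only at this ⊢
      linarith [hle i]
    · right
      have := mul_le_mul_of_nonneg_left h hl0.le
      simp only at this ⊢
      linarith [hle j]
  have hle' : optCost ⟨r, q, w'⟩ τ ≤ ∑ i, (l * s i + w' i) := by
    refine csInf_le ⟨0, ?_⟩ ⟨_, hls, rfl⟩
    rintro _ ⟨s, hs, rfl⟩
    exact Finset.sum_nonneg fun i _ => by linarith [hr i, hs.release_le i, hw' i]
  refine hle'.trans ?_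
  rw [Finset.sum_mul]
  exact Finset.sum_le_sum fun i _ => by
    have := hle i
    simp only
    linarith

/-- The optimal cost is a measurable function of the workloads. -/
lemma measurable_indicator_optCost {τ : ℝ} (hτ : 0 ≤ τ) {r : Fin n → ℝ} (hr : ∀ i, 0 ≤ r i)
    (q : Fin n → Fin k) :
    Measurable ({w : Fin n → ℝ | ∀ i, 0 < w i}.indicator fun w => optCost ⟨r, q, w⟩ τ) := by
  set E := {w : Fin n → ℝ | ∀ i, 0 < w i} with hE
  have hEo : IsOpen E := by
    rw [hE, Set.ofPred_forall]
    exact isOpen_iInter_of_finite fun i => isOpen_lt continuous_const (continuous_apply i)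
  refine measurable_of_Iio fun c => ?_
  have hopen : IsOpen (E ∩ {w | optCost ⟨r, q, w⟩ τ < c}) := by
    rw [isOpen_iff_mem_nhds]
    rintro w₀ ⟨hw₀, hc⟩
    obtain ⟨l, hl, hlc⟩ : ∃ l : ℝ, 1 < l ∧ l * optCost ⟨r, q, w₀⟩ τ < c := by
      have h0 := optCost_nonneg ⟨r, q, w₀⟩ (τ := τ) hr hw₀
      have h1 : Filter.Tendsto (fun l : ℝ => l * optCost ⟨r, q, w₀⟩ τ) (nhdsWithin 1 (Set.Ioi 1))
          (nhds (1 * optCost ⟨r, q, w₀⟩ τ)) :=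
        ((continuous_id.mul continuous_const).tendsto 1).mono_left nhdsWithin_le_nhds
      rw [one_mul] at h1
      obtain ⟨l, h2, h3⟩ := ((h1.eventually (gt_mem_nhds hc)).and self_mem_nhdsWithin).exists
      exact ⟨l, h3, h2⟩
    have hnhds : E ∩ {w | ∀ i, w i < l * w₀ i} ∈ nhds w₀ := by
      refine Filter.inter_mem (hEo.mem_nhds hw₀) (IsOpen.mem_nhds ?_ fun i => ?_)
      · rw [Set.ofPred_forall]
        exact isOpen_iInter_of_finite fun i => isOpen_lt (continuous_apply i) continuous_const
      · exact lt_mul_of_one_lt_left (hw₀ i) hl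
    filter_upwards [hnhds] with w hw
    exact ⟨hw.1, (optCost_le_mul hτ hr hw₀ hw.1 hl.le fun i => (hw.2 i).le).trans_lt hlc⟩
  have heq : (E.indicator fun w => optCost ⟨r, q, w⟩ τ) ⁻¹' Set.Iio c
      = (E ∩ {w | optCost ⟨r, q, w⟩ τ < c}) ∪ (Eᶜ ∩ {_w | 0 < c}) := by
    ext w
    by_cases hw : w ∈ E <;> simp [hw]
  rw [heq]
  exact hopen.measurableSet.union (hEo.measurableSet.compl.inter (.const _))

end PollingInstance

end

/-! ### Averaging over the workloads -/

open PollingInstance in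
theorem mainTheorem12 {Ω : Type*} [MeasurableSpace Ω] (P : Measure Ω) [IsProbabilityMeasure P]
    (k n : ℕ) (hk : 2 ≤ k)
    (τ θ η pmin : ℝ) (hτ : 0 ≤ τ) (hpmin : 0 < pmin) (hτθ : τ ≤ θ * pmin)
    (hηθ : η ≤ θ) (hκ : cyclicRatio k η ≤ θ + 2)
    (r : Fin n → ℝ) (hr : ∀ i, 0 ≤ r i) (q : Fin n → Fin k)
    (D : Measure ℝ) [IsProbabilityMeasure D] (hD : ∀ᵐ x ∂D, pmin ≤ x)
    (p : Fin n → Ω → ℝ) (hlaw : ∀ i, HasLaw (p i) D P) (hindep : iIndepFun p P) :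
    Integrable (fun ω =>
        PollingInstance.mixedCost ⟨r, q, fun i => p i ω⟩ τ (η * pmin) /
          PollingInstance.optCost ⟨r, q, fun i => p i ω⟩ τ) P ∧
      ∫ ω, PollingInstance.mixedCost ⟨r, q, fun i => p i ω⟩ τ (η * pmin) /
          PollingInstance.optCost ⟨r, q, fun i => p i ω⟩ τ ∂P ≤
        cyclicRatio k η * D.real (Set.Iic (η * pmin)) ^ n +
          (θ + 2) * (1 - D.real (Set.Iic (η * pmin)) ^ n) := by
  have hk' : (2 : ℝ) ≤ k := by exact_mod_cast hk
  have hkκ : (k : ℝ) ≤ cyclicRatio k η - 1 := by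
    have h : (k : ℝ) + 1 ≤ cyclicRatio k η := le_max_right _ _
    linarith
  -- If `η ≥ k ≥ 2`, then `3 / 2 * η ≥ η + 1`; this is where the factor `3 / 2` is used.
  have hηκ : η ≤ cyclicRatio k η - 1 := by
    rcases le_total η k with h | h
    · exact h.trans hkκ
    · have h1 : 3 / 2 * η ≤ cyclicRatio k η := le_max_left _ _
      linarith
  set κ := cyclicRatio k η
  set b := η * pmin
  have hθ : 0 ≤ θ := by linarith
  set R : (Fin n → ℝ) → ℝ := fun w =>
    mixedCost ⟨r, q, w⟩ τ b / optCost ⟨r, q, w⟩ τ with hR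
  set μ := Measure.pi fun _ : Fin n => D
  have hp : AEMeasurable (fun ω i => p i ω) P :=
    aemeasurable_pi_lambda _ fun i => (hlaw i).aemeasurable
  have hmap : P.map (fun ω i => p i ω) = μ := by
    rw [(iIndepFun_iff_map_fun_eq_pi_map fun i => (hlaw i).aemeasurable).1 hindep]
    simp only [(hlaw _).map_eq, μ]
  have hae : ∀ᵐ w ∂μ, ∀ i, pmin ≤ w i := by
    rw [ae_all_iff]
    exact fun i => (Measure.quasiMeasurePreserving_eval (fun _ : Fin n => D) i).ae hD
  have hmeas : AEStronglyMeasurable R μ := by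
    have h1 : Measurable fun w : Fin n → ℝ => mixedCost ⟨r, q, w⟩ τ b :=
      measurable_mixedRun (w := fun w => w) measurable_pi_apply n measurable_const _ _
    -- Almost surely the workloads are positive, so cutting off the optimal cost outside the
    -- positive orthant changes nothing.
    refine (h1.div (measurable_indicator_optCost hτ hr q)).aestronglyMeasurable.congr ?_
    filter_upwards [hae] with w hw
    simp only [hR, Pi.div_apply]
    rw [Set.indicator_of_mem]
    exact fun i => hpmin.trans_le (hw i)
  set A : Set (Fin n → ℝ) := Set.univ.pi fun _ => Set.Iic b with hA
  have hAm : MeasurableSet A := MeasurableSet.univ_pi fun _ => measurableSet_Iic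
  have hμA : μ.real A = D.real (Set.Iic b) ^ n := by
    rw [measureReal_def, hA, Measure.pi_pi]
    simp [measureReal_def]
  have hbound : ∀ (w : Fin n → ℝ) (K : ℝ), (∀ i, pmin ≤ w i) → κ ≤ K →
      ((∀ i, w i ≤ b) ∨ K = θ + 2) → R w ≤ K := by
    intro w K hw hK h
    have hw0 : ∀ i, 0 < w i := fun i => hpmin.trans_le (hw i)
    -- This form also covers `n = 0`, where the ratio is `0 / 0 = 0`.
    refine div_le_of_le_mul₀ (optCost_nonneg _ hr hw0) (by linarith) ?_
    exact mixedCost_le_mul_optCost ⟨r, q, w⟩ hτ hθ hr hpmin hw hτθ (by linarith)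
      (mul_le_mul_of_nonneg_right (by linarith) hpmin.le) h
  have hle : ∀ᵐ w ∂μ, R w ≤ (θ + 2) + A.indicator (fun _ => κ - (θ + 2)) w := by
    filter_upwards [hae] with w hw
    by_cases h : w ∈ A
    · rw [Set.indicator_of_mem h]
      linarith [hbound w κ hw le_rfl (Or.inl fun i => h i (Set.mem_univ i))]
    · rw [Set.indicator_of_notMem h]
      linarith [hbound w (θ + 2) hw hκ (Or.inr rfl)]
  have hint : Integrable R μ := by
    refine Integrable.of_bound hmeas (θ + 2) ?_
    filter_upwards [hae] with w hw
    have hw0 : ∀ i, 0 < w i := fun i => hpmin.trans_le (hw i)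
    rw [Real.norm_of_nonneg]
    · exact hbound w (θ + 2) hw hκ (Or.inr rfl)
    · exact div_nonneg (mixedRun_nonneg _ hτ hr hw0 n 0 none _ le_rfl) (optCost_nonneg _ hr hw0)
  have hindic : Integrable (A.indicator fun _ => κ - (θ + 2)) μ :=
    (integrable_const _).indicator hAm
  have hfinal : ∫ w, R w ∂μ ≤ κ * D.real (Set.Iic b) ^ n +
      (θ + 2) * (1 - D.real (Set.Iic b) ^ n) := by
    refine (integral_mono_ae hint ((integrable_const _).add hindic) hle).trans_eq ?_
    simp only [Pi.add_apply]
    rw [integral_add (integrable_const _) hindic, integral_indicator_const _ hAm, hμA]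
    simp only [integral_const, probReal_univ, smul_eq_mul]
    ring
  rw [← hmap] at hint hfinal
  rw [integral_map hp hint.aestronglyMeasurable] at hfinal
  exact ⟨hint.comp_aemeasurable hp, hfinal⟩
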